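/- A matrix pencil is written $\mathcal A(s)=sE-A$ with $E,A\in\mathbb C^{n\times n}$. It is regular if $\det(sE-A)$ is not the zero polynomial, and its rank is the largest $r$ such that the polynomial matrix $sE-A$ has a minor of size $r$ which is not the zero polynomial. For $m\ge 1$, vectors $g_0,\dots,g_{m-1}\in\mathbb C^n$ form a Jordan chain of length $m$ of $\mathcal A$ at $\lambda\in\mathbb C$ if $g_0\ne 0$, $(A-\lambda E)g_0=0$ and $(A-\lambda E)g_{i}=Eg_{i-1}$ for $1\le i\le m-1$; they form a Jordan chain of length $m$ at $\infty$ if $g_0\neq 0$, $Eg_0=0$ and $Eg_i=Ag_{i-1}$ for $1\le i\le m-1$. For $\lambda\in\mathbb C\cup\{\infty\}$ and $l\ge 1$ let $\mathcal L^l_\lambda(\mathcal A)\subseteq\mathbb C^n$ be the linear span of all elements of all Jordan chains of $\mathcal A$ at $\lambda$ of length at most $l$. Let $\mathcal A(s)=sE-A$ be a regular matrix pencil and let $\mathcal P(s)=sF-G$, with $F,G\in\mathbb C^{n\times n}$, be a pencil of rank one such that $(\mathcal A+\mathcal P)(s)=s(E+F)-(A+G)$ is regular. Then for all $\lambda\in\mathbb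 C\cup\{\infty\}$ and all integers $k\ge 1$ $$\left|\dim\frac{\mathcal L_\lambda^{k+1}(\mathcal A+\mathcal P)}{\mathcal L_\lambda^{k}(\mathcal A+\mathcal P)}-\dim\frac{\mathcal L_\lambda^{k+1}(\mathcal A)}{\mathcal L_\lambda^{k}(\mathcal A)}\right|\le 1,$$ $$\left|\dim\mathcal L_\lambda^{k}(\mathcal A+\mathcal P)-\dim\mathcal L_\lambda^{k}(\mathcal A)\right|\le k.$$ -/

import Mathlib

open scoped Polynomial OnePoint

noncomputable section

/-- A square matrix pencil `s E - A` with complex coefficient matrices of size `n × n`. -/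
@[ext]
structure MatrixPencil (n : ℕ) where
  /-- The leading coefficient `E` of `s E - A`. -/
  E : Matrix (Fin n) (Fin n) ℂ
  /-- The matrix `A` of `s E - A`; it enters the pencil with a minus sign. -/
  A : Matrix (Fin n) (Fin n) ℂ

namespace MatrixPencil

variable {n : ℕ}

/-- The sum of pencils: `(s E - A) + (s F - G) = s (E + F) - (A + G)`. -/
instance : Add (MatrixPencil n) := ⟨fun P Q => ⟨P.E + Q.E, P.A + Q.A⟩⟩

/-- The pencil `s E - A` viewed as a matrix with polynomial entries. -/
def toPoly (P : MatrixPencil n) : Matrix (Fin n) (Fin n) ℂ[X] :=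
  (Polynomial.X : ℂ[X]) • P.E.map Polynomial.C - P.A.map Polynomial.C

/-- The pencil is regular: `det (s E - A)` is not the zero polynomial. -/
def IsRegular (P : MatrixPencil n) : Prop := P.toPoly.det ≠ 0

/-- The rank of a pencil: the largest `r` such that the polynomial matrix `s E - A` has a minor
of size `r` which is not the zero polynomial. (The set below contains `0` and is bounded by `n`.) -/
def rank (P : MatrixPencil n) : ℕ :=
  sSup {r : ℕ | ∃ f g : Fin r ↪ Fin n, (P.toPoly.submatrix f g).det ≠ 0}

/-- `P.IsJordanChain z m g`: the vectors `g 0, …, g (m - 1)` form a Jordan chain of length `m ≥ 1`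
of the pencil `s E - A` at the point `z` of the extended complex plane. The values of `g` at
indices `≥ m` play no role. -/
def IsJordanChain (P : MatrixPencil n) : OnePoint ℂ → ℕ → (ℕ → Fin n → ℂ) → Prop
  | ∞, m, g =>
      1 ≤ m ∧ g 0 ≠ 0 ∧ P.E.mulVec (g 0) = 0 ∧
        ∀ i, i + 1 < m → P.E.mulVec (g (i + 1)) = P.A.mulVec (g i)
  | (z : ℂ), m, g =>
      1 ≤ m ∧ g 0 ≠ 0 ∧ (P.A - z • P.E).mulVec (g 0) = 0 ∧
        ∀ i, i + 1 < m → (P.A - z • P.E).mulVec (g (i + 1)) = P.E.mulVec (g i)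

/-- The subspace `L_z^l` of all elements of all Jordan chains up to the length `l` at `z`.
The set of all such elements does not contain `0` if the pencil is regular, so the subspace meant
is its linear span (for a regular pencil this only adds the vector `0` to the set). -/
def rootSubspace (P : MatrixPencil n) (z : OnePoint ℂ) (l : ℕ) : Submodule ℂ (Fin n → ℂ) :=
  Submodule.span ℂ
    {x | ∃ (j : ℕ) (g : ℕ → Fin n → ℂ), j < l ∧ P.IsJordanChain z (j + 1) g ∧ g j = x}

/-- The dimension of the quotient space `L_z^{k+1} / L_z^k`. -/
def quotDim (P : MatrixPencil n) (z : OnePoint ℂ) (k : ℕ) : ℕ :=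
  Module.finrank ℂ
    (P.rootSubspace z (k + 1) ⧸ (P.rootSubspace z k).submoduleOf (P.rootSubspace z (k + 1)))

end MatrixPencil

end

/-! Let N g_{i+1} = M g_i be the chain equations at λ. Regularity gives μ ≠ 0 such that B = N - μM
is invertible, with one μ serving both pencils. Multiplication by B⁻¹ turns N into S = B⁻¹N and M
into a multiple of 1 - S, which is invertible on ker S^l; hence L^l = ker S^l
(`rootSubspace_eq_ker_pow`).

A rank-one pencil has a constant column or row factor (`exists_vecMulVec_of_rank_one`), so S, or the
similar matrix N B⁻¹, changes to S' = S + φ(·)u. Both operators agree on the S-invariant subspace W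
of ker S^(k+1) where all φ ∘ S^i vanish, and W + ker S^k has codimension at most one in ker S^(k+1).
Thus dim ker S^(k+1) - dim ker S^k drops by at most one (`finrank_ker_pow_succ_add_le`). Exchanging
the pencils gives the first bound, and summing gives the second. -/

open Module LinearMap

/-! ### Kernels of powers under a rank-one perturbation. -/

section RankOnePerturbation

variable {K V : Type*} [Field K] [AddCommGroup V] [Module K V]

/-- The largest subspace of `ker S ^ m` that is invariant under `S` and annihilated by `φ`. -/
def unobservableKer (S : End K V) (φ : V →ₗ[K] K) (m : ℕ) : Submodule K V where
  carrier := {x | (S ^ m) x = 0 ∧ ∀ i, φ ((S ^ i) x) = 0}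
  add_mem' := by
    rintro x y ⟨hx, hx'⟩ ⟨hy, hy'⟩
    exact ⟨by simp [hx, hy], fun i => by simp [hx', hy']⟩
  zero_mem' := by simp
  smul_mem' := by
    rintro c x ⟨hx, hx'⟩
    exact ⟨by simp [hx], fun i => by simp [hx']⟩

theorem pow_apply_eq_of_unobservable {S S' : End K V} {φ : V →ₗ[K] K} {u : V}
    (h : ∀ x, S' x = S x + φ x • u) {x : V} (hx : ∀ i, φ ((S ^ i) x) = 0) (i : ℕ) :
    (S' ^ i) x = (S ^ i) x := by
  induction i with
  | zero => simp
  | succ i ih => rw [pow_succ', pow_succ', Module.End.mul_apply, Module.End.mul_apply, ih, h, hx]; simp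

/-- The functionals φ ∘ S^i are killed one at a time, from the highest i down, by subtracting
multiples of S^j y for a single y. For j ≥ 1 these vectors lie in ker S^k, so only y itself costs a
dimension. -/
theorem exists_ker_pow_succ_le (S : End K V) (φ : V →ₗ[K] K) (k : ℕ) :
    ∃ y : V, ker (S ^ (k + 1)) ≤
      (unobservableKer S φ (k + 1) ⊔ ker (S ^ k)) ⊔ Submodule.span K {y} := by
  classical
  have hpow : ∀ {x : V} {i j : ℕ}, (S ^ i) x = 0 → i ≤ j → (S ^ j) x = 0 := by
    intro x i j hx hij
    obtain ⟨d, rfl⟩ := Nat.exists_eq_add_of_le hij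
    rw [add_comm, pow_add, Module.End.mul_apply, hx, map_zero]
  by_cases hall : ∀ x ∈ ker (S ^ (k + 1)), ∀ i, φ ((S ^ i) x) = 0
  · refine ⟨0, fun x hx => ?_⟩
    exact Submodule.mem_sup_left (Submodule.mem_sup_left ⟨hx, hall x hx⟩)
  push Not at hall
  obtain ⟨x₀, hx₀, i₀, hi₀⟩ := hall
  let Q : ℕ → Prop := fun i => ∃ x ∈ ker (S ^ (k + 1)), φ ((S ^ i) x) ≠ 0
  have hi₀k : i₀ ≤ k := by
    by_contra hlt
    exact hi₀ (by rw [hpow hx₀ (by omega), map_zero])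
  obtain ⟨y, hy, hym⟩ : Q (Nat.findGreatest Q k) :=
    Nat.findGreatest_spec hi₀k ⟨x₀, hx₀, hi₀⟩
  set m := Nat.findGreatest Q k with hm
  have hvanish : ∀ x ∈ ker (S ^ (k + 1)), ∀ i, m < i → φ ((S ^ i) x) = 0 := by
    intro x hx i hi
    by_contra hne
    rcases le_or_gt i k with hik | hik
    · exact Nat.findGreatest_is_greatest hi hik ⟨x, hx, hne⟩
    · exact hne (by rw [hpow hx (by omega), map_zero])
  have key : ∀ h ≤ m + 1, ∀ x ∈ ker (S ^ (k + 1)), (∀ i, h ≤ i → φ ((S ^ i) x) = 0) →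
      x ∈ (unobservableKer S φ (k + 1) ⊔ ker (S ^ k)) ⊔ Submodule.span K {y} := by
    intro h
    induction h with
    | zero =>
      intro _ x hx hx'
      exact Submodule.mem_sup_left (Submodule.mem_sup_left ⟨hx, fun i => hx' i (Nat.zero_le i)⟩)
    | succ h ih =>
      intro hh x hx hx'
      -- The shift makes φ ∘ S^h the last functional that is nonzero on v.
      set v := (S ^ (m - h)) y with hv
      have hSv : ∀ i, (S ^ i) v = (S ^ (i + (m - h))) y := fun i => by
        rw [hv, pow_add, Module.End.mul_apply]
      have hvker : v ∈ ker (S ^ (k + 1)) := by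
        rw [mem_ker, hSv]; exact hpow hy (by omega)
      have hvh : φ ((S ^ h) v) ≠ 0 := by
        rw [hSv, show h + (m - h) = m by omega]; exact hym
      have hvmem : v ∈ (unobservableKer S φ (k + 1) ⊔ ker (S ^ k)) ⊔ Submodule.span K {y} := by
        rcases Nat.eq_zero_or_pos (m - h) with h0 | h0
        · refine Submodule.mem_sup_right ?_
          rw [hv, h0]; simp
        · refine Submodule.mem_sup_left (Submodule.mem_sup_right ?_)
          rw [mem_ker, hSv]; exact hpow hy (by omega)
      set c := φ ((S ^ h) x) / φ ((S ^ h) v) with hc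
      have hsub : x - c • v ∈
          (unobservableKer S φ (k + 1) ⊔ ker (S ^ k)) ⊔ Submodule.span K {y} := by
        refine ih (by omega) _ (sub_mem hx (Submodule.smul_mem _ _ hvker)) fun i hi => ?_
        rw [map_sub, map_smul, map_sub, map_smul, smul_eq_mul]
        rcases eq_or_lt_of_le hi with rfl | hi
        · rw [hc, div_mul_cancel₀ _ hvh, sub_self]
        · rw [hx' i hi, hSv, hvanish y hy _ (by omega)]; simp
      have := add_mem hsub (Submodule.smul_mem _ c hvmem)
      rwa [sub_add_cancel] at this
  exact ⟨y, fun x hx => key (m + 1) le_rfl x hx fun i hi => hvanish x hx i hi⟩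

/-- Since W meets ker S^k and ker S'^k in the same subspace, W / (W ∩ ker S^k) embeds in ker
S'^(k+1) / ker S'^k. -/
theorem finrank_ker_pow_succ_add_le [FiniteDimensional K V] {S S' : End K V} {φ : V →ₗ[K] K}
    {u : V} (h : ∀ x, S' x = S x + φ x • u) (k : ℕ) :
    finrank K (ker (S ^ (k + 1))) + finrank K (ker (S' ^ k)) ≤
      finrank K (ker (S' ^ (k + 1))) + finrank K (ker (S ^ k)) + 1 := by
  obtain ⟨y, hy⟩ := exists_ker_pow_succ_le S φ k
  set W := unobservableKer S φ (k + 1) with hW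
  have h1 : finrank K (ker (S ^ (k + 1))) ≤ finrank K ↥(W ⊔ ker (S ^ k)) + 1 := by
    refine (Submodule.finrank_mono hy).trans ((Submodule.finrank_add_le_finrank_add_finrank _ _).trans ?_)
    exact Nat.add_le_add_left ((finrank_span_le_card _).trans (by simp)) _
  have h2 := Submodule.finrank_sup_add_finrank_inf_eq W (ker (S ^ k))
  have h3 := Submodule.finrank_sup_add_finrank_inf_eq W (ker (S' ^ k))
  have hinf : W ⊓ ker (S' ^ k) = W ⊓ ker (S ^ k) := by
    ext x
    simp only [Submodule.mem_inf, mem_ker]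
    refine and_congr_right fun hx => ?_
    rw [pow_apply_eq_of_unobservable h hx.2]
  have h4 : finrank K ↥(W ⊔ ker (S' ^ k)) ≤ finrank K (ker (S' ^ (k + 1))) := by
    refine Submodule.finrank_mono (sup_le (fun x hx => ?_) fun x hx => ?_)
    · rw [mem_ker, pow_apply_eq_of_unobservable h hx.2]; exact hx.1
    · rw [mem_ker] at hx ⊢
      rw [pow_succ', Module.End.mul_apply, hx, map_zero]
  rw [hinf] at h3
  omega

end RankOnePerturbation

/-! ### Jordan chains and kernels of powers. -/

section Chains

variable {K V : Type*} [Field K] [AddCommGroup V] [Module K V]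

theorem pow_apply_chain {S T : End K V} (hST : Commute S T) {g : ℕ → V} {m : ℕ}
    (hg : ∀ i, i + 1 < m → S (g (i + 1)) = T (g i)) :
    ∀ i, i < m → (S ^ i) (g i) = (T ^ i) (g 0) := by
  intro i
  induction i with
  | zero => simp
  | succ i ih =>
    intro hi
    rw [pow_succ, Module.End.mul_apply, hg i hi, ← Module.End.mul_apply,
      (hST.pow_left i).eq, Module.End.mul_apply, ih (by omega), pow_succ', Module.End.mul_apply]

theorem exists_chain_iff_mem_ker_pow {S T : End K V} {c : K} (hc : c ≠ 0)
    (hT : T = c • (1 - S)) {l : ℕ} {x : V} (hx : x ≠ 0) :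
    (∃ (j : ℕ) (g : ℕ → V), j < l ∧ g 0 ≠ 0 ∧ S (g 0) = 0 ∧
      (∀ i, i + 1 < j + 1 → S (g (i + 1)) = T (g i)) ∧ g j = x) ↔ x ∈ ker (S ^ l) := by
  have hST : Commute S T := by
    rw [hT]
    exact ((Commute.one_right S).sub_right (Commute.refl S)).smul_right c
  constructor
  · rintro ⟨j, g, hj, -, h0, hg, rfl⟩
    obtain ⟨d, rfl⟩ := Nat.exists_eq_add_of_lt hj
    have := pow_apply_chain hST hg j (by omega)
    rw [mem_ker, show j + d + 1 = d + (1 + j) by ring, pow_add, pow_add, pow_one,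
      Module.End.mul_apply, Module.End.mul_apply, this, ← Module.End.mul_apply S,
      (hST.pow_right j).eq, Module.End.mul_apply, h0, map_zero, map_zero]
  · intro hxl
    classical
    have hex : ∃ i, (S ^ i) x = 0 := ⟨l, hxl⟩
    have hspec := Nat.find_spec hex
    have hmin := fun i => Nat.find_min (H := hex) (m := i)
    have hle : Nat.find hex ≤ l := Nat.find_min' hex hxl
    obtain ⟨j, hj⟩ : ∃ j, Nat.find hex = j + 1 := by
      refine Nat.exists_eq_succ_of_ne_zero fun h0 => hx ?_
      rw [h0] at hspec
      simpa using hspec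
    rw [hj] at hspec hmin hle
    -- On ker S^l the geometric sum R inverts T, so g_i = (RS)^(j-i) x solves S g_{i+1} = T g_i and
    -- ends at x.
    set R : End K V := c⁻¹ • ∑ i ∈ Finset.range l, S ^ i with hR
    have hSR : Commute S R :=
      (Commute.sum_right _ _ _ fun i _ => (Commute.refl S).pow_right i).smul_right _
    have hTR : T * R = 1 - S ^ l := by
      rw [hT, hR, smul_mul_smul_comm, mul_inv_cancel₀ hc, one_smul, mul_neg_geom_sum]
    have hker : ∀ i, (S ^ l) (((R * S) ^ i) x) = 0 := fun i => by
      rw [← Module.End.mul_apply, (((hSR.pow_left l).mul_right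
        ((Commute.refl S).pow_left l)).pow_right i).eq, Module.End.mul_apply, mem_ker.1 hxl,
        map_zero]
    have hrec : ∀ i, i + 1 < j + 1 →
        S (((R * S) ^ (j - (i + 1))) x) = T (((R * S) ^ (j - i)) x) := by
      intro i hi
      rw [show j - i = j - (i + 1) + 1 by omega, pow_succ' (R * S), Module.End.mul_apply (R * S),
        Module.End.mul_apply R, ← Module.End.mul_apply T, hTR, LinearMap.sub_apply, Module.End.one_apply,
        ← Module.End.mul_apply (S ^ l), ← pow_succ, pow_succ', Module.End.mul_apply S (S ^ l),
        hker, map_zero, sub_zero]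
    refine ⟨j, fun i => ((R * S) ^ (j - i)) x, by omega, fun h0 => ?_, ?_, hrec, by simp⟩
    -- If g_0 = 0, then S^j x = T^j g_0 = 0, against the minimality of j + 1.
    · have := pow_apply_chain hST (g := fun i => ((R * S) ^ (j - i)) x) hrec j (by omega)
      simp only [show ((R * S) ^ (j - 0)) x = 0 from h0, map_zero] at this
      exact hmin j (by omega) (by simpa using this)
    · change S (((R * S) ^ j) x) = 0
      rw [hSR.symm.mul_pow, Module.End.mul_apply, ← Module.End.mul_apply S,
        (hSR.pow_right j).eq, Module.End.mul_apply, ← Module.End.mul_apply S, ← pow_succ',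
        hspec, map_zero]

end Chains

/-! ### Factorisation of rank-one pencils. -/

section RankOneMatrices

theorem exists_eq_mul_of_minors_eq_zero {ι κ K : Type*} [Field K] {F : Matrix ι κ K}
    (h : ∀ i j k l, F i j * F k l = F i l * F k j) :
    ∃ (u : ι → K) (a : κ → K), ∀ i j, F i j = u i * a j := by
  by_cases h0 : ∀ i j, F i j = 0
  · exact ⟨0, 0, by simp [h0]⟩
  push Not at h0
  obtain ⟨p, q, hpq⟩ := h0
  refine ⟨fun i => F i q, fun j => F p j / F p q, fun i j => ?_⟩
  rw [mul_div_assoc', eq_div_iff hpq]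
  exact h i j p q

theorem exists_common_multiple {ι K : Type*} [Field K] {u v : ι → K}
    (h : ∀ i k, u i * v k = v i * u k) : ∃ (c : ι → K) (α β : K), u = α • c ∧ v = β • c := by
  by_cases h0 : u = 0
  · exact ⟨v, 0, 1, by simp [h0], by simp⟩
  obtain ⟨p, hp⟩ := Function.ne_iff.1 h0
  simp only [Pi.zero_apply] at hp
  refine ⟨u, 1, v p / u p, by simp, funext fun i => ?_⟩
  simp only [Pi.smul_apply, smul_eq_mul]
  rw [div_mul_eq_mul_div, eq_div_iff hp, ← h p i, mul_comm]

end RankOneMatrices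

namespace MatrixPencil

variable {n : ℕ}

theorem toPoly_apply (P : MatrixPencil n) (i j : Fin n) :
    P.toPoly i j = Polynomial.X * Polynomial.C (P.E i j) - Polynomial.C (P.A i j) := by
  simp [toPoly]

theorem bddAbove_minor_sizes (P : MatrixPencil n) :
    BddAbove {r : ℕ | ∃ f g : Fin r ↪ Fin n, (P.toPoly.submatrix f g).det ≠ 0} :=
  ⟨n, fun r ⟨f, _, _⟩ => by simpa using Fintype.card_le_of_embedding f⟩

theorem minor_two_eq_zero {P : MatrixPencil n} (hP : P.rank = 1) (i j k l : Fin n) :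
    P.toPoly i j * P.toPoly k l = P.toPoly i l * P.toPoly k j := by
  rcases eq_or_ne i k with rfl | hik
  · ring
  rcases eq_or_ne j l with rfl | hjl
  · ring
  by_contra hne
  have hmem : 2 ∈ {r : ℕ | ∃ f g : Fin r ↪ Fin n, (P.toPoly.submatrix f g).det ≠ 0} := by
    have hinj : ∀ {a b : Fin n}, a ≠ b → Function.Injective ![a, b] := by
      intro a b hab x y hxy
      fin_cases x <;> fin_cases y <;> simp_all
    refine ⟨⟨![i, k], hinj hik⟩, ⟨![j, l], hinj hjl⟩, ?_⟩
    rw [Matrix.det_fin_two]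
    simpa [sub_eq_zero] using hne
  have := le_csSup P.bddAbove_minor_sizes hmem
  change 2 ≤ P.rank at this
  omega

theorem minors_of_rank_one {P : MatrixPencil n} (hP : P.rank = 1) (i j k l : Fin n) :
    P.E i j * P.E k l = P.E i l * P.E k j ∧ P.A i j * P.A k l = P.A i l * P.A k j ∧
      P.E i j * P.A k l + P.A i j * P.E k l = P.E i l * P.A k j + P.A i l * P.E k j := by
  have h := fun x : ℂ => congrArg (Polynomial.eval x) (minor_two_eq_zero hP i j k l)
  simp only [toPoly_apply, Polynomial.eval_mul, Polynomial.eval_sub, Polynomial.eval_X,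
    Polynomial.eval_C] at h
  -- The minors are quadratic in s, so three values determine their coefficients.
  have h0 := h 0
  have h1 := h 1
  have h2 := h (-1)
  refine ⟨?_, ?_, ?_⟩
  · linear_combination (1 / 2 : ℂ) * h1 + (1 / 2 : ℂ) * h2 - h0
  · linear_combination h0
  · linear_combination (-1 / 2 : ℂ) * h1 + (1 / 2 : ℂ) * h2

/-- A pencil of rank one has a constant column or a constant row factor. -/
theorem exists_vecMulVec_of_rank_one {P : MatrixPencil n} (hP : P.rank = 1) :
    (∃ c a b : Fin n → ℂ, P.E = Matrix.vecMulVec c a ∧ P.A = Matrix.vecMulVec c b) ∨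
      ∃ c a b : Fin n → ℂ, P.E = Matrix.vecMulVec a c ∧ P.A = Matrix.vecMulVec b c := by
  have hm := minors_of_rank_one hP
  obtain ⟨u, a, hE⟩ := exists_eq_mul_of_minors_eq_zero fun i j k l => (hm i j k l).1
  obtain ⟨v, b, hA⟩ := exists_eq_mul_of_minors_eq_zero fun i j k l => (hm i j k l).2.1
  -- The mixed coefficient is a minor of (u, v) times a minor of (a, b), so one of the two pairs is
  -- linearly dependent.
  have hx : ∀ i k j l, (u i * v k - v i * u k) * (a j * b l - b j * a l) = 0 := by
    intro i k j l
    have := (hm i j k l).2.2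
    rw [hE, hE, hE, hE, hA, hA, hA, hA] at this
    linear_combination this
  by_cases huv : ∀ i k, u i * v k = v i * u k
  · obtain ⟨c, α, β, rfl, rfl⟩ := exists_common_multiple huv
    refine Or.inl ⟨c, α • a, β • b, ?_, ?_⟩ <;> ext i j
    · simp only [hE, Matrix.vecMulVec_apply, Pi.smul_apply, smul_eq_mul]; ring
    · simp only [hA, Matrix.vecMulVec_apply, Pi.smul_apply, smul_eq_mul]; ring
  · push Not at huv
    obtain ⟨i, k, hik⟩ := huv
    have hab : ∀ j l, a j * b l = b j * a l := fun j l =>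
      sub_eq_zero.1 ((mul_eq_zero.1 (hx i k j l)).resolve_left (sub_ne_zero.2 hik))
    obtain ⟨c, α, β, rfl, rfl⟩ := exists_common_multiple hab
    refine Or.inr ⟨c, α • u, β • v, ?_, ?_⟩ <;> ext i j
    · simp only [hE, Matrix.vecMulVec_apply, Pi.smul_apply, smul_eq_mul]; ring
    · simp only [hA, Matrix.vecMulVec_apply, Pi.smul_apply, smul_eq_mul]; ring

/-! ### Reduction of a regular pencil to one operator. -/

/-- The matrix whose kernel consists of the eigenvectors at the point `z`. -/
def eigMatrix (P : MatrixPencil n) : OnePoint ℂ → Matrix (Fin n) (Fin n) ℂ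
  | ∞ => P.E
  | (z : ℂ) => P.A - z • P.E

/-- The matrix on the right-hand side of the Jordan chain equations at the point `z`. -/
def chainMatrix (P : MatrixPencil n) : OnePoint ℂ → Matrix (Fin n) (Fin n) ℂ
  | ∞ => P.A
  | (_ : ℂ) => P.E

theorem isJordanChain_iff (P : MatrixPencil n) (z : OnePoint ℂ) (m : ℕ) (g : ℕ → Fin n → ℂ) :
    P.IsJordanChain z m g ↔ 1 ≤ m ∧ g 0 ≠ 0 ∧ (P.eigMatrix z).mulVec (g 0) = 0 ∧
      ∀ i, i + 1 < m → (P.eigMatrix z).mulVec (g (i + 1)) = (P.chainMatrix z).mulVec (g i) := by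
  induction z using OnePoint.rec <;> rfl

theorem eval_det_toPoly (P : MatrixPencil n) (s : ℂ) :
    P.toPoly.det.eval s = (s • P.E - P.A).det := by
  rw [← Polynomial.coe_evalRingHom, RingHom.map_det]
  congr 1
  ext i j
  simp only [RingHom.mapMatrix_apply, Matrix.map_apply, toPoly_apply, Polynomial.coe_evalRingHom,
    Polynomial.eval_sub, Polynomial.eval_mul, Polynomial.eval_X, Polynomial.eval_C,
    Matrix.sub_apply, Matrix.smul_apply, smul_eq_mul]

theorem exists_isUnit_eigMatrix_sub {A B : MatrixPencil n} (hA : A.IsRegular)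
    (hB : B.IsRegular) (z : OnePoint ℂ) : ∃ μ : ℂ, μ ≠ 0 ∧
      IsUnit (A.eigMatrix z - μ • A.chainMatrix z) ∧
        IsUnit (B.eigMatrix z - μ • B.chainMatrix z) := by
  have hfin : ∀ w : ℂ, ∃ s : ℂ, s ≠ w ∧ (s • A.E - A.A).det ≠ 0 ∧ (s • B.E - B.A).det ≠ 0 := by
    intro w
    -- The factor X - w excludes s = w, which keeps μ = s - z (at z) or μ = s⁻¹ (at ∞, with w = 0)
    -- well defined and nonzero.
    have hne : (A.toPoly.det * B.toPoly.det * (Polynomial.X - Polynomial.C w) : ℂ[X]) ≠ 0 :=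
      mul_ne_zero (mul_ne_zero hA hB) (Polynomial.X_sub_C_ne_zero w)
    obtain ⟨s, hs⟩ : ∃ s, (A.toPoly.det * B.toPoly.det *
        (Polynomial.X - Polynomial.C w) : ℂ[X]).eval s ≠ 0 := by
      by_contra! hall
      exact hne (Polynomial.funext fun x => by simpa using hall x)
    simp only [Polynomial.eval_mul, Polynomial.eval_sub, Polynomial.eval_X, Polynomial.eval_C,
      mul_ne_zero_iff, eval_det_toPoly, sub_ne_zero] at hs
    exact ⟨s, hs.2, hs.1.1, hs.1.2⟩
  induction z using OnePoint.rec with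
  | infty =>
    obtain ⟨s, hs, h1, h2⟩ := hfin 0
    have hunit : ∀ Q : MatrixPencil n, (s • Q.E - Q.A).det ≠ 0 →
        IsUnit (Q.E - s⁻¹ • Q.A) := by
      intro Q hQ
      have : Q.E - s⁻¹ • Q.A = s⁻¹ • (s • Q.E - Q.A) := by
        rw [smul_sub, smul_smul, inv_mul_cancel₀ hs, one_smul]
      rw [Matrix.isUnit_iff_isUnit_det, this, Matrix.det_smul]
      exact (mul_ne_zero (pow_ne_zero _ (inv_ne_zero hs)) hQ).isUnit
    exact ⟨s⁻¹, inv_ne_zero hs, hunit A h1, hunit B h2⟩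
  | coe z =>
    obtain ⟨s, hs, h1, h2⟩ := hfin z
    have hunit : ∀ Q : MatrixPencil n, (s • Q.E - Q.A).det ≠ 0 →
        IsUnit (Q.A - z • Q.E - (s - z) • Q.E) := by
      intro Q hQ
      have : Q.A - z • Q.E - (s - z) • Q.E = -(s • Q.E - Q.A) := by
        rw [sub_smul]; abel
      rw [this, IsUnit.neg_iff, Matrix.isUnit_iff_isUnit_det]
      exact hQ.isUnit
    exact ⟨s - z, sub_ne_zero.2 hs, hunit A h1, hunit B h2⟩

theorem rootSubspace_eq_ker_pow (P : MatrixPencil n) (z : OnePoint ℂ) {μ : ℂ} (hμ : μ ≠ 0)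
    {B : Matrix (Fin n) (Fin n) ℂ} (hB : B = P.eigMatrix z - μ • P.chainMatrix z)
    (hu : IsUnit B) (l : ℕ) :
    P.rootSubspace z l = ker ((B⁻¹ * P.eigMatrix z).toLin' ^ l) := by
  have hinv : B⁻¹ * B = 1 := Matrix.nonsing_inv_mul _ ((Matrix.isUnit_iff_isUnit_det _).1 hu)
  have hinj : ∀ v w : Fin n → ℂ, (B⁻¹).mulVec v = (B⁻¹).mulVec w ↔ v = w := by
    refine fun v w => ⟨fun h => ?_, fun h => by rw [h]⟩
    have hinv' : B * B⁻¹ = 1 := Matrix.mul_nonsing_inv _ ((Matrix.isUnit_iff_isUnit_det _).1 hu)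
    simpa [Matrix.mulVec_mulVec, hinv'] using congrArg B.mulVec h
  set S := (B⁻¹ * P.eigMatrix z).toLin' with hS
  set T := (B⁻¹ * P.chainMatrix z).toLin' with hT
  have hTS : T = (-μ⁻¹) • (1 - S) := by
    have : B⁻¹ * P.chainMatrix z = (-μ⁻¹) • (1 - B⁻¹ * P.eigMatrix z) := by
      have h : P.chainMatrix z = (-μ⁻¹) • (B - P.eigMatrix z) := by
        rw [hB, sub_sub_cancel_left, neg_smul, smul_neg, neg_neg, smul_smul,
          inv_mul_cancel₀ hμ, one_smul]
      rw [h, Matrix.mul_smul, mul_sub, hinv]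
    rw [hT, this, map_smul, map_sub, Matrix.toLin'_one, hS]
    rfl
  have hset : ∀ x : Fin n → ℂ, x ≠ 0 →
      ((∃ (j : ℕ) (g : ℕ → Fin n → ℂ), j < l ∧ P.IsJordanChain z (j + 1) g ∧ g j = x) ↔
        x ∈ ker (S ^ l)) := by
    intro x hx
    rw [← exists_chain_iff_mem_ker_pow (neg_ne_zero.2 (inv_ne_zero hμ)) hTS hx]
    refine exists_congr fun j => exists_congr fun g => and_congr_right fun _ => ?_
    have h0 : (B⁻¹).mulVec ((P.eigMatrix z).mulVec (g 0)) = 0 ↔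
        (P.eigMatrix z).mulVec (g 0) = 0 := by
      simpa using hinj ((P.eigMatrix z).mulVec (g 0)) 0
    simp only [isJordanChain_iff, hS, hT, Matrix.toLin'_apply, ← Matrix.mulVec_mulVec, hinj, h0]
    simp only [le_add_iff_nonneg_left, zero_le, true_and, and_assoc]
  apply le_antisymm
  · refine Submodule.span_le.2 fun x hx => ?_
    rcases eq_or_ne x 0 with rfl | hx0
    · exact zero_mem _
    · exact (hset x hx0).1 hx
  · intro x hx
    rcases eq_or_ne x 0 with rfl | hx0
    · exact zero_mem _
    · exact Submodule.subset_span ((hset x hx0).2 hx)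

/-- The two matrices are conjugate by B. This lets a constant row factor be treated through N B⁻¹.
-/
theorem finrank_ker_pow_conj (N B : Matrix (Fin n) (Fin n) ℂ) (hu : IsUnit B) (l : ℕ) :
    finrank ℂ (ker ((B⁻¹ * N).toLin' ^ l)) = finrank ℂ (ker ((N * B⁻¹).toLin' ^ l)) := by
  have hd := (Matrix.isUnit_iff_isUnit_det _).1 hu
  have hpow : (B⁻¹ * N) ^ l = B⁻¹ * (N * B⁻¹) ^ l * B := by
    induction l with
    | zero => simp [Matrix.nonsing_inv_mul _ hd]
    | succ l ih =>
      rw [pow_succ, ih, pow_succ]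
      simp only [mul_assoc]
      rw [Matrix.mul_nonsing_inv_cancel_left _ _ hd, Matrix.nonsing_inv_mul _ hd, mul_one]
  have hr : ((B⁻¹ * N) ^ l).rank = ((N * B⁻¹) ^ l).rank := by
    rw [hpow, Matrix.rank_mul_eq_left_of_isUnit_det _ _ hd, Matrix.rank_mul_eq_right_of_isUnit_det]
    exact Matrix.isUnit_nonsing_inv_det _ hd
  have h1 := finrank_range_add_finrank_ker ((B⁻¹ * N) ^ l).mulVecLin
  have h2 := finrank_range_add_finrank_ker ((N * B⁻¹) ^ l).mulVecLin
  rw [Matrix.rank, Matrix.rank] at hr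
  rw [← Matrix.toLin'_pow, ← Matrix.toLin'_pow]
  rw [hr, ← h2] at h1
  exact Nat.add_left_cancel h1

/-! ### Comparison of the two pencils. -/

theorem finrank_ker_pow_succ_add_le_of_vecMulVec {S S' : Matrix (Fin n) (Fin n) ℂ}
    {c a : Fin n → ℂ} (h : S' = S + Matrix.vecMulVec c a) (k : ℕ) :
    finrank ℂ (ker (S.toLin' ^ (k + 1))) + finrank ℂ (ker (S'.toLin' ^ k)) ≤
      finrank ℂ (ker (S'.toLin' ^ (k + 1))) + finrank ℂ (ker (S.toLin' ^ k)) + 1 := by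
  refine finrank_ker_pow_succ_add_le (φ := dotProductBilin ℂ ℂ a) (u := c) (fun x => ?_) k
  rw [h, map_add, LinearMap.add_apply]
  congr 1
  ext i
  simp [Matrix.vecMulVec_mulVec, mul_comm]

/-- The growth `dim L^{k+1} - dim L^k` of a regular pencil drops by at most one when both
coefficients are perturbed so that the perturbing pencil has a constant column or row factor. -/
theorem finrank_rootSubspace_succ_add_le {A A' : MatrixPencil n} (hA : A.IsRegular)
    (hA' : A'.IsRegular) (z : OnePoint ℂ)
    (h : (∃ c a b : Fin n → ℂ, A'.E = A.E + Matrix.vecMulVec c a ∧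
        A'.A = A.A + Matrix.vecMulVec c b) ∨
      ∃ c a b : Fin n → ℂ, A'.E = A.E + Matrix.vecMulVec a c ∧
        A'.A = A.A + Matrix.vecMulVec b c) (k : ℕ) :
    finrank ℂ (A.rootSubspace z (k + 1)) + finrank ℂ (A'.rootSubspace z k) ≤
      finrank ℂ (A'.rootSubspace z (k + 1)) + finrank ℂ (A.rootSubspace z k) + 1 := by
  obtain ⟨μ, hμ, hu, hu'⟩ := exists_isUnit_eigMatrix_sub hA hA' z
  rw [A.rootSubspace_eq_ker_pow z hμ rfl hu, A.rootSubspace_eq_ker_pow z hμ rfl hu,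
    A'.rootSubspace_eq_ker_pow z hμ rfl hu', A'.rootSubspace_eq_ker_pow z hμ rfl hu']
  set N := A.eigMatrix z with hN
  set N' := A'.eigMatrix z with hN'
  set B := N - μ • A.chainMatrix z with hB
  set B' := N' - μ • A'.chainMatrix z with hB'
  have hd := (Matrix.isUnit_iff_isUnit_det _).1 hu
  have hd' := (Matrix.isUnit_iff_isUnit_det _).1 hu'
  rcases h with ⟨c, a, b, hE, hG⟩ | ⟨c, a, b, hE, hG⟩
  · obtain ⟨r, t, hr, ht⟩ : ∃ r t, N' = N + Matrix.vecMulVec c r ∧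
        B' = B + Matrix.vecMulVec c t := by
      induction z using OnePoint.rec with
      | infty =>
        refine ⟨a, a - μ • b, hE, ?_⟩
        simp only [hB', hB, hN', hN, eigMatrix, chainMatrix, hE, hG, Matrix.vecMulVec_sub,
          Matrix.vecMulVec_smul, smul_add]
        abel
      | coe z =>
        refine ⟨b - z • a, b - z • a - μ • a, ?_, ?_⟩ <;>
        · simp only [hB', hB, hN', hN, eigMatrix, chainMatrix, hE, hG, Matrix.vecMulVec_sub,
            Matrix.vecMulVec_smul, smul_add]
          abel
    refine finrank_ker_pow_succ_add_le_of_vecMulVec (c := (B'⁻¹).mulVec c)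
      (a := r - Matrix.vecMul t (B⁻¹ * N)) ?_ k
    rw [← Matrix.mul_vecMulVec, Matrix.vecMulVec_sub, ← Matrix.vecMulVec_mul]
    -- Substituting N = B S and B = B' - c tᵀ gives S' = S + (B'⁻¹ c)(rᵀ - tᵀ S).
    have h1 : N + Matrix.vecMulVec c r = B' * (B⁻¹ * N) +
        (Matrix.vecMulVec c r - Matrix.vecMulVec c t * (B⁻¹ * N)) := by
      rw [ht, add_mul, Matrix.mul_nonsing_inv_cancel_left _ _ hd]
      abel
    rw [hr, h1, mul_add, Matrix.nonsing_inv_mul_cancel_left _ _ hd']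
  · obtain ⟨r, t, hr, ht⟩ : ∃ r t, N' = N + Matrix.vecMulVec r c ∧
        B' = B + Matrix.vecMulVec t c := by
      induction z using OnePoint.rec with
      | infty =>
        refine ⟨a, a - μ • b, hE, ?_⟩
        simp only [hB', hB, hN', hN, eigMatrix, chainMatrix, hE, hG, Matrix.sub_vecMulVec,
          Matrix.smul_vecMulVec, smul_add]
        abel
      | coe z =>
        refine ⟨b - z • a, b - z • a - μ • a, ?_, ?_⟩ <;>
        · simp only [hB', hB, hN', hN, eigMatrix, chainMatrix, hE, hG, Matrix.sub_vecMulVec,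
            Matrix.smul_vecMulVec, smul_add]
          abel
    simp only [finrank_ker_pow_conj _ _ hu, finrank_ker_pow_conj _ _ hu']
    refine finrank_ker_pow_succ_add_le_of_vecMulVec
      (c := r - (N * B⁻¹).mulVec t) (a := Matrix.vecMul c B'⁻¹) ?_ k
    rw [← Matrix.vecMulVec_mul, Matrix.sub_vecMulVec, ← Matrix.mul_vecMulVec]
    -- The mirror image: N' B'⁻¹ = N B⁻¹ + (r - N B⁻¹ t)(cᵀ B'⁻¹).
    have h1 : N + Matrix.vecMulVec r c = N * B⁻¹ * B' +
        (Matrix.vecMulVec r c - N * B⁻¹ * Matrix.vecMulVec t c) := by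
      rw [ht, mul_add, Matrix.nonsing_inv_mul_cancel_right _ _ hd]
      abel
    rw [hr, h1, add_mul, Matrix.mul_nonsing_inv_cancel_right _ _ hd']

theorem rootSubspace_mono (P : MatrixPencil n) (z : OnePoint ℂ) : Monotone (P.rootSubspace z) :=
  fun _ _ hkl => Submodule.span_mono fun _ ⟨j, g, hj, hg⟩ => ⟨j, g, hj.trans_le hkl, hg⟩

theorem finrank_rootSubspace_zero (P : MatrixPencil n) (z : OnePoint ℂ) :
    finrank ℂ (P.rootSubspace z 0) = 0 := by
  have h : P.rootSubspace z 0 = ⊥ := by simp [rootSubspace]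
  rw [h, finrank_bot]

theorem quotDim_add_finrank (P : MatrixPencil n) (z : OnePoint ℂ) (k : ℕ) :
    P.quotDim z k + finrank ℂ (P.rootSubspace z k) = finrank ℂ (P.rootSubspace z (k + 1)) := by
  rw [quotDim, ← (Submodule.submoduleOfEquivOfLe
    (P.rootSubspace_mono z (Nat.le_succ k))).finrank_eq]
  exact Submodule.finrank_quotient_add_finrank _

end MatrixPencil

theorem proposition4p2 {n : ℕ} (A P : MatrixPencil n) (hA : A.IsRegular)
    (hP : P.rank = 1) (hAP : (A + P).IsRegular) (z : OnePoint ℂ) (k : ℕ) (hk : 1 ≤ k) :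
    |((A + P).quotDim z k : ℤ) - (A.quotDim z k : ℤ)| ≤ 1 ∧
      |(Module.finrank ℂ ((A + P).rootSubspace z k) : ℤ) -
        (Module.finrank ℂ (A.rootSubspace z k) : ℤ)| ≤ (k : ℤ) := by
  have hEA : (A + P).E = A.E + P.E ∧ (A + P).A = A.A + P.A := ⟨rfl, rfl⟩
  have hup := MatrixPencil.finrank_rootSubspace_succ_add_le hA hAP z (by
    rcases MatrixPencil.exists_vecMulVec_of_rank_one hP with ⟨c, a, b, hE, hG⟩ | ⟨c, a, b, hE, hG⟩
    · exact Or.inl ⟨c, a, b, by rw [hEA.1, hE], by rw [hEA.2, hG]⟩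
    · exact Or.inr ⟨c, a, b, by rw [hEA.1, hE], by rw [hEA.2, hG]⟩)
  -- The original pencil is in turn a perturbation of A + P, with a and b negated.
  have hdown := MatrixPencil.finrank_rootSubspace_succ_add_le hAP hA z (by
    rcases MatrixPencil.exists_vecMulVec_of_rank_one hP with ⟨c, a, b, hE, hG⟩ | ⟨c, a, b, hE, hG⟩
    · exact Or.inl ⟨c, -a, -b, by rw [hEA.1, hE, Matrix.vecMulVec_neg, add_neg_cancel_right],
        by rw [hEA.2, hG, Matrix.vecMulVec_neg, add_neg_cancel_right]⟩
    · exact Or.inr ⟨c, -a, -b, by rw [hEA.1, hE, Matrix.neg_vecMulVec, add_neg_cancel_right],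
        by rw [hEA.2, hG, Matrix.neg_vecMulVec, add_neg_cancel_right]⟩)
  constructor
  · have h1 := A.quotDim_add_finrank z k
    have h2 := (A + P).quotDim_add_finrank z k
    have h3 := hup k
    have h4 := hdown k
    rw [abs_le]
    omega
  -- Telescoping from L^0 = 0: each step changes the difference by at most one.
  · clear hk
    induction k with
    | zero => rw [MatrixPencil.finrank_rootSubspace_zero, MatrixPencil.finrank_rootSubspace_zero]; simp
    | succ k ih =>
      have h3 := hup k
      have h4 := hdown k
      rw [abs_le] at ih ⊢
      push_cast
      omega
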